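/- Let $\mathcal{A}$ be a finite alphabet with at least two letters, with the discrete topology, and let $\theta:\mathcal{A}\to\mathcal{A}^*$ be a substitution, extended to words by concatenation. For a word $w$, let $|w|$ be its length, $w_j$ its $j$-th letter and $w_{<j}=w_1\cdots w_{j-1}$. Let $M$ be the matrix whose entry $M_{a,b}$ is the number of occurrences of $a$ in $\theta(b)$. Assume that $\theta$ is primitive: for some $k\ge 1$ all entries of $M^k$ are positive. Let $$X_\theta=\{x\in\mathcal{A}^{\mathbb{Z}} : \text{every finite word occurring in } x \text{ occurs in } \theta^n(a) \text{ for some } n\ge 0,\ a\in\mathcal{A}\}$$ with the topology induced by the product topology, and let $T$ be the shift $(Tx)_n=x_{n+1}$ on $X_\theta$. A continuous $\varphi:X_\theta\to\mathbb{C}$ is called a coboundary if $\varphi=g-g\circ T$ for some continuous $g:X_\theta\to\mathbb{C}$. For $f:\mathcal{A}\to\mathbb{C}$ and a word $w=a_1\cdots a_k$ put $S_f(w)=f(a_1)+\cdots+f(a_k)$. Let $\mathcal{X}=\{(a,j): a\in\mathcal{A},\ 1\le j\le|\theta(a)|\}$. Let $\lambda$ be the Perron–Frobenius eigenvalue of $M$,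 and let $\rho$ and $\sigma$ be positive right and left eigenvectors of $M$ for $\lambda$ with $\sum_a\sigma(a)\rho(a)=1$. Set $\hat\rho(a,j)=\rho(a)$ and $\hat\sigma(a,j)=\lambda^{-1}\sigma(\theta(a)_j)$, and let $\mathfrak{n}$ be the finite measure on $\mathcal{A}$ given by $$\int_{\mathcal{A}} f\,d\mathfrak{n}=\sum_{(a,j)\in\mathcal{X}}\hat\sigma(a,j)\,\hat\rho(a,j)\,S_f(\theta(a)_{<j}).$$ Let $f:\mathcal{A}\to\mathbb{C}$ be a left eigenfunction of $M$, that is, $f\ne 0$ and $\sum_a f(a)M_{a,b}=\lambda_f f(b)$ for all $b\in\mathcal{A}$, with $|\lambda_f|=1$. Then the following are equivalent. (i) The function $w\mapsto f(w_1)$ from $X_\theta$ to $\mathbb{C}$ is a coboundary. (ii) There exists $w\in X_\theta$ such that $\sup_{N}|S_f(w_1w_2\cdots w_N)|<\infty$. (iii) There is a function $h:\mathcal{A}\to\mathbb{C}$ such that for all $(a,j)\in\mathcal{X}$ $$S_f(\theta(a)_{<j})=\int_{\mathcal{A}} f\,d\mathfrak{n}+h(a)-\lambda_f^{-1}h(\theta(a)_j).$$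 (iv) There is a function $h:\mathcal{A}\to\mathbb{C}$ such that (a) for all $(a,j)\in\mathcal{X}$ with $1\le j<|\theta(a)|$, $\ f(\theta(a)_j)=\lambda_f^{-1}\bigl(h(\theta(a)_j)-h(\theta(a)_{j+1})\bigr)$; and (b) for all $a\in\mathcal{A}$, $\ \int_{\mathcal{A}} f\,d\mathfrak{n}+h(a)-\lambda_f^{-1}h(\theta(a)_1)=0$. -/

import Mathlib

open scoped Matrix

namespace SubstitutionSystem

section PerronFrobenius

variable {ι : Type*} [Fintype ι]

/-- Perron-Frobenius data of a square real matrix `A`: the eigenvalue `val`, a strictly positive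
right eigenvector `right` and a strictly positive left eigenvector `left`, normalized so that
their pairing is `1`. For a primitive `A` such data exist, `val` is the Perron-Frobenius
eigenvalue, and `right`, `left` are unique up to replacing them by `c • right`, `c⁻¹ • left`. -/
structure PerronFrobenius (A : Matrix ι ι ℝ) where
  val : ℝ
  right : ι → ℝ
  left : ι → ℝ
  val_pos : 0 < val
  right_pos : ∀ a, 0 < right a
  left_pos : ∀ a, 0 < left a
  mulVec_right : A *ᵥ right = val • right
  vecMul_left : left ᵥ* A = val • left
  normalized : ∑ a, left a * right a = 1

theorem exists_pos_eigenvector [DecidableEq ι] [Nonempty ι] {A : Matrix ι ι ℝ}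
    (hA : A.IsPrimitive) :
    ∃ (r : ℝ) (v : ι → ℝ), 0 < r ∧ (∀ i, 0 < v i) ∧ A *ᵥ v = r • v := by
  obtain ⟨hnn, k, hkpos, hk⟩ := hA
  have hpos : ∀ x : ι → ℝ, (∀ i, 0 ≤ x i) → x ≠ 0 → ∀ i, 0 < ((A ^ k) *ᵥ x) i := by
    intro x hx hne i
    obtain ⟨j, hj⟩ := Function.ne_iff.mp hne
    have hj' : 0 < x j := lt_of_le_of_ne (hx j) (Ne.symm hj)
    exact Finset.sum_pos' (fun l _ => mul_nonneg (hk i l).le (hx l))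
      ⟨j, Finset.mem_univ j, mul_pos (hk i j) hj'⟩
  have hcomm : ∀ x : ι → ℝ, A *ᵥ ((A ^ k) *ᵥ x) = (A ^ k) *ᵥ (A *ᵥ x) := by
    intro x
    rw [Matrix.mulVec_mulVec, Matrix.mulVec_mulVec, ← pow_succ', ← pow_succ]
  set C : ℝ := ∑ i, ∑ j, A i j with hC
  let S : Set (ℝ × (ι → ℝ)) :=
    (Set.Icc 0 C ×ˢ stdSimplex ℝ ι) ∩ {p | ∀ i, p.1 * p.2 i ≤ (A *ᵥ p.2) i}
  have hScl : IsClosed {p : ℝ × (ι → ℝ) | ∀ i, p.1 * p.2 i ≤ (A *ᵥ p.2) i} := by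
    rw [Set.ofPred_forall]
    refine isClosed_iInter fun i => isClosed_le (by fun_prop) ?_
    simp only [Matrix.mulVec, dotProduct]
    fun_prop
  have hScomp : IsCompact S := (isCompact_Icc.prod (isCompact_stdSimplex ℝ ι)).inter_right hScl
  have hCnn : 0 ≤ C := Finset.sum_nonneg fun i _ => Finset.sum_nonneg fun j _ => hnn i j
  have hSne : S.Nonempty := by
    obtain ⟨i₀⟩ := ‹Nonempty ι›
    refine ⟨(0, Pi.single i₀ 1), ⟨⟨⟨le_rfl, hCnn⟩, single_mem_stdSimplex ℝ i₀⟩, ?_⟩⟩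
    intro i
    simp only [zero_mul]
    exact Finset.sum_nonneg fun j _ =>
      mul_nonneg (hnn i j) ((single_mem_stdSimplex ℝ i₀).1 j)
  obtain ⟨⟨r, x⟩, hmem, hmax⟩ := hScomp.exists_isMaxOn hSne continuous_fst.continuousOn
  obtain ⟨⟨⟨hr0, -⟩, hx⟩, hle⟩ := hmem
  simp only [Set.mem_ofPred_eq] at hle hr0
  have hxne : x ≠ 0 := by
    rintro rfl
    have h1 := hx.2
    simp at h1
  have heig : A *ᵥ x = r • x := by
    by_contra hne
    set y : ι → ℝ := A *ᵥ x - r • x with hy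
    have hyne : y ≠ 0 := sub_ne_zero.mpr hne
    have hynn : ∀ i, 0 ≤ y i := fun i => by
      simpa [hy] using hle i
    have hypos := hpos y hynn hyne
    set z : ι → ℝ := (A ^ k) *ᵥ x with hz
    have hzpos : ∀ i, 0 < z i := hpos x hx.1 hxne
    have hAz : A *ᵥ z - r • z = (A ^ k) *ᵥ y := by
      rw [hy, Matrix.mulVec_sub, Matrix.mulVec_smul, hz, hcomm]
    have hlt : ∀ i, r * z i < (A *ᵥ z) i := fun i => by
      have h2 := hypos i
      rw [← hAz] at h2
      simpa using h2
    obtain ⟨i₁, -, hi₁⟩ := Finset.exists_min_image Finset.univ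
      (fun i => (A *ᵥ z) i / z i) Finset.univ_nonempty
    set t : ℝ := (A *ᵥ z) i₁ / z i₁ with ht
    have hrt : r < t := by
      rw [ht, lt_div_iff₀ (hzpos i₁)]
      exact hlt i₁
    have htle : ∀ i, t * z i ≤ (A *ᵥ z) i := fun i => by
      have h3 := hi₁ i (Finset.mem_univ i)
      exact (le_div_iff₀ (hzpos i)).mp h3
    set s : ℝ := ∑ i, z i with hs
    have hspos : 0 < s := Finset.sum_pos (fun i _ => hzpos i) Finset.univ_nonempty
    set w : ι → ℝ := s⁻¹ • z with hw
    have hwmem : w ∈ stdSimplex ℝ ι := by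
      refine ⟨fun i => ?_, ?_⟩
      · exact mul_nonneg (inv_nonneg.mpr hspos.le) (hzpos i).le
      · simp only [hw, Pi.smul_apply, smul_eq_mul]
        rw [← Finset.mul_sum, inv_mul_cancel₀ hspos.ne']
    have htw : ∀ i, t * w i ≤ (A *ᵥ w) i := fun i => by
      rw [hw, Matrix.mulVec_smul]
      simp only [Pi.smul_apply, smul_eq_mul]
      have h4 := mul_le_mul_of_nonneg_left (htle i) (inv_nonneg.mpr hspos.le)
      linarith
    have htC : t ≤ C := by
      have h5 : t * ∑ i, w i ≤ ∑ i, (A *ᵥ w) i := by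
        rw [Finset.mul_sum]
        exact Finset.sum_le_sum fun i _ => htw i
      rw [hwmem.2, mul_one] at h5
      refine h5.trans ?_
      refine Finset.sum_le_sum fun i _ => Finset.sum_le_sum fun j _ => ?_
      have h6 : w j ≤ 1 := hwmem.2 ▸
        Finset.single_le_sum (fun l _ => hwmem.1 l) (Finset.mem_univ j)
      exact mul_le_of_le_one_right (hnn i j) h6
    have hle2 : t ≤ r := hmax (show (t, w) ∈ S from ⟨⟨⟨hr0.trans hrt.le, htC⟩, hwmem⟩, htw⟩)
    exact absurd hrt (not_lt.mpr hle2)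
  have hpow : ∀ m : ℕ, (A ^ m) *ᵥ x = r ^ m • x := by
    intro m
    induction m with
    | zero => simp
    | succ m ih =>
      rw [pow_succ, ← Matrix.mulVec_mulVec, heig, Matrix.mulVec_smul, ih, smul_smul, pow_succ,
        mul_comm]
  have hxpos : ∀ i, 0 < x i := fun i => by
    have h7 := hpos x hx.1 hxne i
    rw [hpow k] at h7
    exact (lt_of_le_of_ne (hx.1 i) fun h8 => by simp [← h8] at h7)
  refine ⟨r, x, lt_of_le_of_ne hr0 fun h0 => ?_, hxpos, heig⟩
  have hAx : A *ᵥ x = 0 := by rw [heig, ← h0, zero_smul]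
  have h9 : (A ^ k) *ᵥ (A *ᵥ x) = 0 := by rw [hAx, Matrix.mulVec_zero]
  have hA0 : A = 0 := by
    ext i j
    have h10 := congrFun hAx i
    simp only [Matrix.mulVec, dotProduct, Pi.zero_apply] at h10
    rw [Finset.sum_eq_zero_iff_of_nonneg
      (fun l _ => mul_nonneg (hnn i l) (hxpos l).le)] at h10
    simpa [(hxpos j).ne'] using h10 j (Finset.mem_univ j)
  obtain ⟨i₀⟩ := ‹Nonempty ι›
  have h11 := hk i₀ i₀
  rw [hA0, zero_pow hkpos.ne'] at h11
  exact absurd h11 (lt_irrefl 0)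

theorem nonempty_perronFrobenius [DecidableEq ι] [Nonempty ι] {A : Matrix ι ι ℝ}
    (hA : A.IsPrimitive) : Nonempty (PerronFrobenius A) := by
  obtain ⟨r, v, hr, hv, hAv⟩ := exists_pos_eigenvector hA
  have hAt : Aᵀ.IsPrimitive := by
    obtain ⟨hnn, k, hk0, hk⟩ := hA
    refine ⟨fun i j => hnn j i, k, hk0, fun i j => ?_⟩
    rw [← Matrix.transpose_pow]
    exact hk j i
  obtain ⟨q, u, -, hu, hAu⟩ := exists_pos_eigenvector hAt
  rw [Matrix.mulVec_transpose] at hAu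
  have hs : 0 < u ⬝ᵥ v := Finset.sum_pos (fun i _ => mul_pos (hu i) (hv i)) Finset.univ_nonempty
  have hqr : q = r := by
    have h1 : (u ᵥ* A) ⬝ᵥ v = u ⬝ᵥ (A *ᵥ v) := (Matrix.dotProduct_mulVec u A v).symm
    rw [hAu, hAv, smul_dotProduct, dotProduct_smul, smul_eq_mul, smul_eq_mul] at h1
    exact mul_right_cancel₀ hs.ne' h1
  subst hqr
  refine ⟨⟨q, v, (u ⬝ᵥ v)⁻¹ • u, hr, hv, fun a => mul_pos (inv_pos.mpr hs) (hu a), hAv, ?_, ?_⟩⟩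
  · rw [Matrix.smul_vecMul, hAu, smul_comm]
  · change ((u ⬝ᵥ v)⁻¹ • u) ⬝ᵥ v = 1
    rw [smul_dotProduct, smul_eq_mul, inv_mul_cancel₀ hs.ne']

end PerronFrobenius

section Substitution

variable {𝒜 : Type*}

/-- The extension of a substitution `θ` to finite words by concatenation. -/
def extend (θ : 𝒜 → List 𝒜) (w : List 𝒜) : List 𝒜 := w.flatMap θ

/-- The language of `θ`: the words occurring in `θ^n(a)` for some `n ≥ 0` and some letter `a`. -/
def language (θ : 𝒜 → List 𝒜) : Set (List 𝒜) :=
  {w | ∃ (n : ℕ) (a : 𝒜), w <:+: (extend θ)^[n] [a]}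

/-- The two-sided substitution subshift `X_θ`: bi-infinite sequences all of whose finite factors
`x_i x_{i+1} ⋯ x_{i+n-1}` lie in the language of `θ`. -/
def subshift (θ : 𝒜 → List 𝒜) : Set (ℤ → 𝒜) :=
  {x | ∀ (i : ℤ) (n : ℕ), List.ofFn (fun k : Fin n => x (i + (k : ℕ))) ∈ language θ}

/-- The shift `(T x)_n = x_{n+1}` on `X_θ`. -/
def shift (θ : 𝒜 → List 𝒜) (x : subshift θ) : subshift θ :=
  ⟨fun n => x.1 (n + 1), fun i n => by
    have h := x.2 (i + 1) n
    have e : (fun k : Fin n => x.1 (i + 1 + (k : ℕ))) =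
        fun k : Fin n => x.1 (i + (k : ℕ) + 1) := by
      funext k
      exact congrArg x.1 (add_right_comm i 1 ((k : ℕ) : ℤ))
    rw [e] at h
    exact h⟩

/-- A (continuous) complex function `φ` on a topological space `X` is a coboundary for `T : X → X` if
`φ = g - g ∘ T` for some continuous `g : X → ℂ`. -/
def IsCoboundary {X : Type*} [TopologicalSpace X] (T : X → X) (φ : X → ℂ) : Prop :=
  ∃ g : X → ℂ, Continuous g ∧ ∀ x, φ x = g x - g (T x)

/-- `S_f(a₁ ⋯ a_k) = f(a₁) + ⋯ + f(a_k)`. -/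
def wordSum (f : 𝒜 → ℂ) (w : List 𝒜) : ℂ := (w.map f).sum

/-- The initial word `w_{≤ N} = w₁ w₂ ⋯ w_N` of a bi-infinite sequence. -/
def initialWord (w : ℤ → 𝒜) (N : ℕ) : List 𝒜 :=
  List.ofFn (fun k : Fin N => w ((k : ℕ) + 1))

/-- The state space of pairs `(a, j)`, `j` a position in `θ(a)`. Positions are counted from `0`
here, so `⟨a, j⟩` stands for the pair `(a, j + 1)` in one-based notation. -/
abbrev State (θ : 𝒜 → List 𝒜) : Type _ := Σ a : 𝒜, Fin (θ a).length

/-- The letter of `θ(a)` at the position of the state `x = (a, j)`. -/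
def State.letter {θ : 𝒜 → List 𝒜} (x : State θ) : 𝒜 := (θ x.1).get x.2

/-- The part of `θ(a)` strictly before the position of the state `x = (a, j)`. -/
def State.before {θ : 𝒜 → List 𝒜} (x : State θ) : List 𝒜 := (θ x.1).take x.2

variable [Fintype 𝒜] [DecidableEq 𝒜]

/-- The `θ`-matrix: `M a b` is the number of occurrences of `a` in `θ(b)`. -/
def substMatrix (θ : 𝒜 → List 𝒜) : Matrix 𝒜 𝒜 ℤ := fun a b => ((θ b).count a : ℤ)

/-- The `θ`-matrix with real entries. -/
def substMatrixReal (θ : 𝒜 → List 𝒜) : Matrix 𝒜 𝒜 ℝ := (substMatrix θ).map (Int.cast : ℤ → ℝ)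

/-- The `θ`-matrix with complex entries. -/
def substMatrixComplex (θ : 𝒜 → List 𝒜) : Matrix 𝒜 𝒜 ℂ :=
  (substMatrix θ).map (Int.cast : ℤ → ℂ)

/-- A substitution is primitive if its matrix is. -/
def IsPrimitive (θ : 𝒜 → List 𝒜) : Prop := (substMatrix θ).IsPrimitive

/-- `f` is a left eigenfunction of the `θ`-matrix with eigenvalue `μ`. -/
def IsLeftEigenfunction (θ : 𝒜 → List 𝒜) (f : 𝒜 → ℂ) (μ : ℂ) : Prop :=
  f ≠ 0 ∧ f ᵥ* substMatrixComplex θ = μ • f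

theorem IsPrimitive.real {θ : 𝒜 → List 𝒜} (hθ : IsPrimitive θ) :
    (substMatrixReal θ).IsPrimitive := by
  obtain ⟨hnn, k, hk0, hk⟩ := hθ
  refine ⟨fun i j => Int.cast_nonneg (hnn i j), k, hk0, fun i j => ?_⟩
  have h : substMatrixReal θ ^ k = (substMatrix θ ^ k).map (Int.cast : ℤ → ℝ) :=
    (Matrix.map_pow (substMatrix θ) (Int.castRingHom ℝ) k).symm
  rw [h]
  exact Int.cast_pos.mpr (hk i j)

theorem IsPrimitive.ne_nil {θ : 𝒜 → List 𝒜} (hθ : IsPrimitive θ) (a : 𝒜) : θ a ≠ [] := by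
  intro h
  obtain ⟨-, k, hk0, hk⟩ := hθ
  obtain ⟨m, rfl⟩ := Nat.exists_eq_succ_of_ne_zero (Nat.pos_iff_ne_zero.mp hk0)
  have h1 := hk a a
  have h2 : ∀ l, substMatrix θ l a = 0 := fun l => by simp [substMatrix, h]
  rw [pow_succ, Matrix.mul_apply] at h1
  simp [h2] at h1

variable [Nonempty 𝒜]

/-- The Perron-Frobenius data `(λ, ρ, σ)` of the matrix of a primitive substitution. -/
noncomputable def perronFrobenius {θ : 𝒜 → List 𝒜} (hθ : IsPrimitive θ) :
    PerronFrobenius (substMatrixReal θ) :=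
  (nonempty_perronFrobenius hθ.real).some

/-- `σ̂(a,j) = λ⁻¹ σ(θ(a)_j)`. -/
noncomputable def sigmaHat {θ : 𝒜 → List 𝒜} (hθ : IsPrimitive θ) (x : State θ) : ℝ :=
  (perronFrobenius hθ).val⁻¹ * (perronFrobenius hθ).left x.letter

/-- `ρ̂(a,j) = ρ(a)`. -/
noncomputable def rhoHat {θ : 𝒜 → List 𝒜} (hθ : IsPrimitive θ) (x : State θ) : ℝ :=
  (perronFrobenius hθ).right x.1

/-- The integral `∫ f d𝔫`, where by definition
`∫ f d𝔫 = ∑_{(a,j)} σ̂(a,j) ρ̂(a,j) S_f(θ(a)_{<j})`. It does not depend on the scaling of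
`ρ` and `σ`, by the normalization `∑ σ(a) ρ(a) = 1`. -/
noncomputable def integralN {θ : 𝒜 → List 𝒜} (hθ : IsPrimitive θ) (f : 𝒜 → ℂ) : ℂ :=
  ∑ x : State θ, ((sigmaHat hθ x * rhoHat hθ x : ℝ) : ℂ) * wordSum f x.before

end Substitution

end SubstitutionSystem

open scoped Matrix

/-! A cycle (i) → (ii) → (iii) → (iv) → (i). The step (i) → (ii) is telescoping, with a transfer
function bounded by compactness.

The core is (ii) → (iii). Primitivity makes every word of the language recur in all long words, so a
bound along one point bounds S_f on the whole language (`IsPrimitive.exists_norm_wordSum_le`). For a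
letter b, let R(b) be the set of sums S_f(p) with pb in the language. Along an edge from a to
θ(a)_j, the map z ↦ λ_f z + S_f(θ(a)_{<j}) sends R(a) into R(θ(a)_j), and it is an isometry because
|λ_f| = 1. The radius of the smallest enclosing disc is therefore monotone along edges, hence
constant by primitivity. Uniqueness of that disc forces centres to go to centres, and the centres
solve the twisted cohomological equation (`IsPrimitive.exists_transfer`). The constant ∫ f d𝔫 is
absorbed into h if λ_f ≠ 1, and vanishes by stationarity of the weights σ̂ρ̂ if λ_f = 1.

(iii) ↔ (iv) is summation by parts inside each θ(a). For (iv) → (i), the relation between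
neighbouring letters passes from θ^n(a) to θ^{n+1}(a), so it holds throughout the subshift
(`isChain_iterate_extend`). -/

namespace SubstitutionSystem

/-! ### Smallest enclosing balls. -/

section Circumcenter

variable {E : Type*} [NormedAddCommGroup E] [InnerProductSpace ℝ E]

/-- A nonempty bounded subset of a proper space is contained in a closed ball of minimal radius. -/
theorem exists_minimal_closedBall {X : Type*} [PseudoMetricSpace X] [ProperSpace X] {S : Set X}
    (hne : S.Nonempty) (hb : Bornology.IsBounded S) :
    ∃ (c : X) (r : ℝ), S ⊆ Metric.closedBall c r ∧
      ∀ (c' : X) (r' : ℝ), S ⊆ Metric.closedBall c' r' → r ≤ r' := by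
  obtain ⟨s, hs⟩ := hne
  obtain ⟨R, hR⟩ := hb.subset_closedBall s
  have hcl : IsClosed {p : X × ℝ | ∀ x ∈ S, dist x p.1 ≤ p.2} := by
    simp only [Set.ofPred_forall]
    exact isClosed_iInter fun x => isClosed_iInter fun _ =>
      isClosed_le (continuous_const.dist continuous_fst) continuous_snd
  -- Any enclosing ball of radius at most R has its centre within R of s, so it suffices to minimise
  -- the radius over this compact set of pairs.
  have hcomp : IsCompact (Metric.closedBall s R ×ˢ Set.Icc 0 R ∩
      {p : X × ℝ | ∀ x ∈ S, dist x p.1 ≤ p.2}) :=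
    ((isCompact_closedBall s R).prod isCompact_Icc).inter_right hcl
  have hR0 : 0 ≤ R := dist_nonneg.trans (hR hs)
  obtain ⟨⟨c, r⟩, ⟨⟨hc, hr⟩, hcr⟩, hmin⟩ := hcomp.exists_isMinOn
    ⟨(s, R), ⟨Metric.mem_closedBall_self hR0, hR0, le_rfl⟩, fun x hx => hR hx⟩
    continuous_snd.continuousOn
  refine ⟨c, r, fun x hx => hcr x hx, fun c' r' h => ?_⟩
  by_contra! hlt
  have h0 : 0 ≤ r' := dist_nonneg.trans (h hs)
  have hrR : r' ≤ R := hlt.le.trans hr.2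
  have h1 : r ≤ r' := hmin (show (c', r') ∈ _ from
    ⟨⟨by rw [Metric.mem_closedBall, dist_comm]; exact (h hs).trans hrR, h0, hrR⟩,
      fun x hx => h hx⟩)
  exact absurd hlt (not_lt.mpr h1)

/-- In an inner product space, the closed ball of minimal radius containing a set is unique. -/
theorem minimal_closedBall_center_unique {S : Set E} (hne : S.Nonempty) {c c' : E} {r : ℝ}
    (hc : S ⊆ Metric.closedBall c r) (hc' : S ⊆ Metric.closedBall c' r)
    (hmin : ∀ (d : E) (t : ℝ), S ⊆ Metric.closedBall d t → r ≤ t) : c = c' := by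
  obtain ⟨s, hs⟩ := hne
  have hr : 0 ≤ r := dist_nonneg.trans (hc hs)
  set m : E := (2⁻¹ : ℝ) • (c + c') with hm
  -- By the parallelogram law, a ball about the midpoint of two distinct centres would be strictly
  -- smaller.
  have key : ∀ x ∈ S, ‖x - m‖ ^ 2 ≤ r ^ 2 - ‖c - c'‖ ^ 2 / 4 := by
    intro x hx
    have h1 : ‖x - c‖ ≤ r := by simpa [dist_eq_norm] using hc hx
    have h2 : ‖x - c'‖ ≤ r := by simpa [dist_eq_norm] using hc' hx
    have h3 := parallelogram_law_with_norm ℝ (x - c) (x - c')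
    have h4 : x - c + (x - c') = (2 : ℝ) • (x - m) := by
      rw [hm]; module
    have h5 : x - c - (x - c') = -(c - c') := by abel
    rw [h4, h5, norm_neg, norm_smul, Real.norm_ofNat] at h3
    nlinarith [norm_nonneg (x - c), norm_nonneg (x - c')]
  have hnn : 0 ≤ r ^ 2 - ‖c - c'‖ ^ 2 / 4 := (sq_nonneg _).trans (key s hs)
  have h6 := hmin m (√(r ^ 2 - ‖c - c'‖ ^ 2 / 4)) fun x hx => by
    rw [Metric.mem_closedBall, dist_eq_norm]
    exact Real.le_sqrt_of_sq_le (key x hx)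
  rw [Real.le_sqrt hr hnn] at h6
  have h7 : ‖c - c'‖ = 0 := by
    have := sq_nonneg ‖c - c'‖
    exact pow_eq_zero_iff (two_ne_zero) |>.mp (by linarith)
  exact sub_eq_zero.mp (norm_eq_zero.mp h7)

end Circumcenter

/-! ### Words, primitivity and the language. -/

section Words

variable {𝒜 : Type*}

/-- A long factor of a concatenation of bounded blocks contains a whole block. -/
theorem exists_mem_isInfix_of_isInfix_flatten {B : ℕ} {v : List 𝒜} (hv : 2 * B < v.length) :
    ∀ {L : List (List 𝒜)}, (∀ l ∈ L, l.length ≤ B) → v <:+: L.flatten → ∃ l ∈ L, l <:+: v := by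
  intro L
  induction L with
  | nil =>
    intro _ h
    rw [List.flatten_nil, List.infix_nil] at h
    simp [h] at hv
  | cons l L ih =>
    rintro hB ⟨p, q, h⟩
    rw [List.flatten_cons, List.append_assoc, List.append_eq_append_iff] at h
    -- Either v begins within the first block or beyond it. In the first case the first two blocks
    -- have total length at most 2B, so v must run through the end of the second one.
    rcases h with ⟨as, hl, h⟩ | ⟨as, hp, h⟩
    · have hlB := hB l (by simp)
      rw [List.append_eq_append_iff] at h
      rcases h with ⟨bs, has, -⟩ | ⟨bs, hvb, h⟩
      · simp [hl, has] at hlB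
        omega
      · cases L with
        | nil =>
          simp at h
          simp [hl] at hlB
          simp [hvb, h.1] at hv
          omega
        | cons l' L =>
          have hl'B := hB l' (by simp)
          rw [List.flatten_cons, List.append_eq_append_iff] at h
          rcases h with ⟨cs, hcs, -⟩ | ⟨cs, hcs, -⟩
          · exact ⟨l', by simp, as, cs, by simp [hvb, hcs]⟩
          · have : bs.length ≤ l'.length := by simp [hcs]
            simp [hvb] at hv
            simp [hl] at hlB
            omega
    · obtain ⟨l', hl', hi⟩ := ih (fun l' hl' => hB l' (by simp [hl'])) ⟨as, q, by simp [h]⟩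
      exact ⟨l', by simp [hl'], hi⟩

theorem wordSum_append (f : 𝒜 → ℂ) (u v : List 𝒜) :
    wordSum f (u ++ v) = wordSum f u + wordSum f v := by
  simp [wordSum]

theorem wordSum_eq_sum_count [Fintype 𝒜] [DecidableEq 𝒜] (f : 𝒜 → ℂ) (w : List 𝒜) :
    wordSum f w = ∑ a, f a * (w.count a : ℂ) := by
  induction w with
  | nil => simp [wordSum]
  | cons b w ih =>
    have h : wordSum f (b :: w) = f b + wordSum f w := by simp [wordSum]
    rw [h, ih]
    simp [List.count_cons, mul_add, Finset.sum_add_distrib, add_comm]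

theorem extend_append (θ : 𝒜 → List 𝒜) (u v : List 𝒜) :
    extend θ (u ++ v) = extend θ u ++ extend θ v := List.flatMap_append

theorem iterate_extend_append (θ : 𝒜 → List 𝒜) (n : ℕ) (u v : List 𝒜) :
    (extend θ)^[n] (u ++ v) = (extend θ)^[n] u ++ (extend θ)^[n] v := by
  induction n generalizing u v with
  | zero => rfl
  | succ n ih => simp only [Function.iterate_succ_apply, extend_append, ih]

theorem iterate_extend_eq_flatten (θ : 𝒜 → List 𝒜) (n : ℕ) (w : List 𝒜) :
    (extend θ)^[n] w = (w.map fun b => (extend θ)^[n] [b]).flatten := by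
  induction w with
  | nil => exact Function.iterate_fixed rfl n
  | cons b w ih =>
    rw [← List.singleton_append, iterate_extend_append, ih]
    simp

theorem isInfix_iterate_extend (θ : 𝒜 → List 𝒜) (n : ℕ) {u v : List 𝒜} (h : u <:+: v) :
    (extend θ)^[n] u <:+: (extend θ)^[n] v := by
  obtain ⟨p, q, rfl⟩ := h
  exact ⟨(extend θ)^[n] p, (extend θ)^[n] q, by simp [iterate_extend_append]⟩

theorem mem_language_of_isInfix {θ : 𝒜 → List 𝒜} {u v : List 𝒜} (h : u <:+: v)
    (hv : v ∈ language θ) : u ∈ language θ := by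
  obtain ⟨n, a, hv⟩ := hv
  exact ⟨n, a, h.trans hv⟩

theorem extend_mem_language {θ : 𝒜 → List 𝒜} {v : List 𝒜} (hv : v ∈ language θ) :
    extend θ v ∈ language θ := by
  obtain ⟨n, a, hv⟩ := hv
  refine ⟨n + 1, a, ?_⟩
  rw [Function.iterate_succ_apply']
  exact isInfix_iterate_extend θ 1 hv

theorem extend_singleton (θ : 𝒜 → List 𝒜) (a : 𝒜) : extend θ [a] = θ a := by simp [extend]

theorem before_append_letter_isPrefix {θ : 𝒜 → List 𝒜} (x : State θ) :
    x.before ++ [x.letter] <+: θ x.1 := by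
  have h : x.before ++ [x.letter] = (θ x.1).take (x.2 + 1) := by
    simp [State.before, State.letter]
  rw [h]
  exact List.take_prefix _ _

variable [Fintype 𝒜] [DecidableEq 𝒜]

theorem count_extend (θ : 𝒜 → List 𝒜) (w : List 𝒜) :
    (fun a => ((extend θ w).count a : ℤ)) = substMatrix θ *ᵥ fun b => (w.count b : ℤ) := by
  funext a
  simp only [Matrix.mulVec, dotProduct, substMatrix]
  induction w with
  | nil => simp [extend]
  | cons b w ih =>
    rw [← List.singleton_append, extend_append, extend_singleton]
    simp only [List.count_append, Nat.cast_add, ih, mul_add, Finset.sum_add_distrib]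
    simp [List.count_singleton]

theorem count_iterate_extend (θ : 𝒜 → List 𝒜) (n : ℕ) (w : List 𝒜) :
    (fun a => (((extend θ)^[n] w).count a : ℤ)) =
      (substMatrix θ ^ n) *ᵥ fun b => (w.count b : ℤ) := by
  induction n with
  | zero => simp
  | succ n ih =>
    rw [Function.iterate_succ_apply', count_extend, ih, Matrix.mulVec_mulVec, ← pow_succ']

/-- The (a, b) entry of M^k counts a in θ^k(b). This is the combinatorial form of primitivity used
below. -/
theorem IsPrimitive.exists_forall_mem {θ : 𝒜 → List 𝒜} (hθ : IsPrimitive θ) :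
    ∃ k, ∀ a b, a ∈ (extend θ)^[k] [b] := by
  obtain ⟨-, k, -, hk⟩ := hθ
  refine ⟨k, fun a b => ?_⟩
  have h := congrFun (count_iterate_extend θ k [b]) a
  have h' : ((substMatrix θ ^ k) *ᵥ fun c => (([b] : List 𝒜).count c : ℤ)) a =
      (substMatrix θ ^ k) a b := by
    simp [Matrix.mulVec, dotProduct, List.count_singleton]
  rw [h'] at h
  have h1 := hk a b
  rw [← h] at h1
  exact List.count_pos_iff.mp (by exact_mod_cast h1)

/-- Some θ^k(b) contains all letters for every b, and there are at least two letters, so θ^k at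
least doubles lengths. Long iterates are then truncated. -/
theorem IsPrimitive.exists_length_eq [Nontrivial 𝒜] {θ : 𝒜 → List 𝒜} (hθ : IsPrimitive θ)
    (N : ℕ) : ∃ v ∈ language θ, v.length = N := by
  obtain ⟨k, hk⟩ := hθ.exists_forall_mem
  have h2 : ∀ b, 2 ≤ ((extend θ)^[k] [b]).length := fun b => by
    have h : (Finset.univ : Finset 𝒜) ⊆ ((extend θ)^[k] [b]).toFinset :=
      fun a _ => List.mem_toFinset.mpr (hk a b)
    have h' := (Finset.card_le_card h).trans (List.toFinset_card_le _)
    rw [Finset.card_univ] at h'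
    exact (Fintype.one_lt_card (α := 𝒜)).trans_le h'
  have hdouble : ∀ w : List 𝒜, 2 * w.length ≤ ((extend θ)^[k] w).length := by
    intro w
    induction w with
    | nil => simp
    | cons b w ih =>
      rw [← List.singleton_append, iterate_extend_append]
      have := h2 b
      simp only [List.length_append, List.length_singleton] at *
      omega
  obtain ⟨a, -⟩ := exists_pair_ne 𝒜
  have hpow : ∀ n, n < (((extend θ)^[k])^[n] [a]).length := by
    intro n
    induction n with
    | zero => simp
    | succ n ih =>
      rw [Function.iterate_succ_apply']
      have := hdouble (((extend θ)^[k])^[n] [a])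
      omega
  refine ⟨(((extend θ)^[k])^[N] [a]).take N, ⟨k * N, a, ?_⟩, ?_⟩
  · rw [Function.iterate_mul]
    exact (List.take_prefix _ _).isInfix
  · rw [List.length_take]
    exact min_eq_left (hpow N).le

/-- Every sufficiently long word of the language contains a given word of the language. -/
theorem IsPrimitive.exists_length_isInfix {θ : 𝒜 → List 𝒜} (hθ : IsPrimitive θ) {u : List 𝒜}
    (hu : u ∈ language θ) :
    ∃ K, ∀ v ∈ language θ, K ≤ v.length → u <:+: v := by
  obtain ⟨n, a, hu⟩ := hu
  obtain ⟨k, hk⟩ := hθ.exists_forall_mem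
  have hub : ∀ b, u <:+: (extend θ)^[n + k] [b] := fun b => by
    rw [Function.iterate_add_apply]
    exact hu.trans (isInfix_iterate_extend θ n ((List.singleton_infix_iff _ _).mpr (hk a b)))
  -- A common bound for the lengths of θ^m(b) over all m ≤ n + k and all letters b.
  set B : ℕ := ∑ m ∈ Finset.range (n + k + 1), ∑ b, ((extend θ)^[m] [b]).length with hB
  have hlen : ∀ m ≤ n + k, ∀ b, ((extend θ)^[m] [b]).length ≤ B := fun m hm b =>
    (Finset.single_le_sum (f := fun b => ((extend θ)^[m] [b]).length)
      (fun _ _ => Nat.zero_le _) (Finset.mem_univ b)).trans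
    (Finset.single_le_sum (f := fun m => ∑ b, ((extend θ)^[m] [b]).length)
      (fun _ _ => Nat.zero_le _) (Finset.mem_range.mpr (Nat.lt_succ_of_le hm)))
  refine ⟨2 * B + 1, fun v hv hvK => ?_⟩
  obtain ⟨m, c, hv⟩ := hv
  rcases lt_or_ge m (n + k) with hm | hm
  -- Early iterates are too short to contain v. Later ones are concatenations of blocks θ^{n+k}(b),
  -- each of which contains u.
  · have h1 := hv.length_le.trans (hlen m hm.le c)
    omega
  · obtain ⟨l, rfl⟩ := Nat.exists_eq_add_of_le hm
    rw [Function.iterate_add_apply, iterate_extend_eq_flatten] at hv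
    obtain ⟨w, hw, hwv⟩ := exists_mem_isInfix_of_isInfix_flatten
      (show 2 * B < v.length by omega) (by
      intro w hw
      obtain ⟨b, -, rfl⟩ := List.mem_map.mp hw
      exact hlen _ le_rfl b) hv
    obtain ⟨b, -, rfl⟩ := List.mem_map.mp hw
    exact (hub b).trans hwv

theorem IsLeftEigenfunction.wordSum_apply {θ : 𝒜 → List 𝒜} {f : 𝒜 → ℂ} {lf : ℂ}
    (hf : IsLeftEigenfunction θ f lf) (b : 𝒜) : wordSum f (θ b) = lf * f b := by
  have h := congrFun hf.2 b
  simpa [wordSum_eq_sum_count, Matrix.vecMul, dotProduct, substMatrixComplex, substMatrix] using h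

theorem IsLeftEigenfunction.wordSum_extend {θ : 𝒜 → List 𝒜} {f : 𝒜 → ℂ} {lf : ℂ}
    (hf : IsLeftEigenfunction θ f lf) (w : List 𝒜) :
    wordSum f (extend θ w) = lf * wordSum f w := by
  induction w with
  | nil => simp [extend, wordSum]
  | cons b w ih =>
    rw [← List.singleton_append, extend_append, extend_singleton, wordSum_append, wordSum_append,
      ih, hf.wordSum_apply, mul_add]
    simp [wordSum]

end Words




/-! ### Bounded sums and the twisted cohomological equation. -/

section Bounded

variable {𝒜 : Type*}

theorem initialWord_mem_language {θ : 𝒜 → List 𝒜} {w : ℤ → 𝒜} (hw : w ∈ subshift θ) (N : ℕ) :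
    initialWord w N ∈ language θ := by
  have h := hw 1 N
  simpa only [initialWord, add_comm] using h

theorem eq_initialWord_of_isPrefix {w : ℤ → 𝒜} {N : ℕ} {p : List 𝒜}
    (h : p <+: initialWord w N) : p = initialWord w p.length := by
  refine List.ext_getElem (by simp [initialWord]) fun i h1 h2 => ?_
  rw [h.getElem h1]
  simp [initialWord]

theorem ofFn_isInfix_ofFn (x : ℤ → 𝒜) {i j : ℤ} {n m : ℕ} (h1 : j ≤ i) (h2 : i + n ≤ j + m) :
    List.ofFn (fun k : Fin n => x (i + (k : ℕ))) <:+: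
      List.ofFn (fun k : Fin m => x (j + (k : ℕ))) := by
  obtain ⟨d, rfl⟩ := Int.exists_add_of_le h1
  have e : List.ofFn (fun k : Fin n => x (j + d + (k : ℕ))) =
      ((List.ofFn (fun k : Fin m => x (j + (k : ℕ)))).drop d).take n := by
    refine List.ext_getElem (by simp; omega) fun k hk1 hk2 => ?_
    simp [add_assoc]
  rw [e]
  exact (List.take_prefix _ _).isInfix.trans (List.drop_suffix _ _).isInfix

variable [Fintype 𝒜] [DecidableEq 𝒜]

/-- Bounded Birkhoff sums along one point give bounded sums over the whole language. -/
theorem IsPrimitive.exists_norm_wordSum_le {θ : 𝒜 → List 𝒜} (hθ : IsPrimitive θ) {f : 𝒜 → ℂ}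
    {w : ℤ → 𝒜} (hw : w ∈ subshift θ)
    (hb : BddAbove (Set.range fun N : ℕ => ‖wordSum f (initialWord w N)‖)) :
    ∃ C, ∀ u ∈ language θ, ‖wordSum f u‖ ≤ C := by
  obtain ⟨C, hC⟩ := hb
  have hC' : ∀ N, ‖wordSum f (initialWord w N)‖ ≤ C := fun N => hC ⟨N, rfl⟩
  refine ⟨C + C, fun u hu => ?_⟩
  -- An occurrence of u in an initial word of w exhibits its sum as a difference of two initial
  -- sums.
  obtain ⟨K, hK⟩ := hθ.exists_length_isInfix hu
  obtain ⟨p, q, hpq⟩ := hK _ (initialWord_mem_language hw K) (by simp [initialWord])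
  have h1 := eq_initialWord_of_isPrefix (⟨q, hpq⟩ : p ++ u <+: initialWord w K)
  have h2 := eq_initialWord_of_isPrefix
    (⟨u ++ q, by rw [← List.append_assoc, hpq]⟩ : p <+: initialWord w K)
  have h3 : wordSum f u = wordSum f (p ++ u) - wordSum f p := by
    rw [wordSum_append]; ring
  rw [h3, h1]
  nth_rewrite 2 [h2]
  exact (norm_sub_le _ _).trans (add_le_add (hC' _) (hC' _))

/-- A function on letters that is monotone along the edges `a → θ(a)_j` is constant. -/
theorem IsPrimitive.eq_of_forall_le {θ : 𝒜 → List 𝒜} (hθ : IsPrimitive θ) {α : Type*}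
    [PartialOrder α] {r : 𝒜 → α} (hr : ∀ x : State θ, r x.1 ≤ r x.letter) (a b : 𝒜) :
    r a = r b := by
  obtain ⟨k, hk⟩ := hθ.exists_forall_mem
  have h : ∀ (n : ℕ) (a b : 𝒜), b ∈ (extend θ)^[n] [a] → r a ≤ r b := by
    intro n
    induction n with
    | zero =>
      intro a b hb
      rw [List.mem_singleton.mp hb]
    | succ n ih =>
      intro a b hb
      rw [Function.iterate_succ_apply'] at hb
      obtain ⟨c, hc, hb⟩ := List.mem_flatMap.mp hb
      obtain ⟨i, rfl⟩ := List.mem_iff_get.mp hb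
      exact (ih a c hc).trans (hr ⟨c, i⟩)
  exact le_antisymm (h k a b (hk b a)) (h k b a (hk a b))

/-- If the sums of `f` over the language are bounded, then the twisted cocycle `S_f(θ(a)_{<j})`
on the edges `a → θ(a)_j` is a twisted coboundary. -/
theorem IsPrimitive.exists_transfer {θ : 𝒜 → List 𝒜} (hθ : IsPrimitive θ) {f : 𝒜 → ℂ} {lf : ℂ}
    (hf : IsLeftEigenfunction θ f lf) (hlf : ‖lf‖ = 1) {C : ℝ}
    (hC : ∀ u ∈ language θ, ‖wordSum f u‖ ≤ C) :
    ∃ c : 𝒜 → ℂ, ∀ x : State θ, c x.letter = lf * c x.1 + wordSum f x.before := by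
  have hlf0 : lf ≠ 0 := by rintro rfl; simp at hlf
  let R : 𝒜 → Set ℂ := fun b => {z | ∃ p, p ++ [b] ∈ language θ ∧ wordSum f p = z}
  have hne : ∀ b, (R b).Nonempty := fun b => ⟨0, [], ⟨0, b, List.infix_rfl⟩, by simp [wordSum]⟩
  have hbd : ∀ b, Bornology.IsBounded (R b) := fun b => by
    refine (Metric.isBounded_closedBall (x := (0 : ℂ)) (r := C)).subset ?_
    rintro z ⟨p, hp, rfl⟩
    rw [mem_closedBall_zero_iff]
    exact hC p (mem_language_of_isInfix (List.prefix_append _ _).isInfix hp)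
  -- If pa is in the language, then so is θ(p)θ(a), hence also its prefix θ(p)θ(a)_{<j} followed by
  -- θ(a)_j.
  have hstep : ∀ (x : State θ), ∀ z ∈ R x.1, lf * z + wordSum f x.before ∈ R x.letter := by
    rintro x z ⟨p, hp, rfl⟩
    refine ⟨extend θ p ++ x.before, ?_, by rw [wordSum_append, hf.wordSum_extend]⟩
    refine mem_language_of_isInfix ?_ (extend_mem_language hp)
    rw [extend_append, extend_singleton, List.append_assoc]
    exact ((List.prefix_append_right_inj _).mpr (before_append_letter_isPrefix x)).isInfix
  choose c r hcr hmin using fun b => exists_minimal_closedBall (hne b) (hbd b)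
  -- Pulling the ball at the target back through the isometry encloses R at the source with the same
  -- radius. Minimality there gives monotonicity of r.
  have hpull : ∀ x : State θ,
      R x.1 ⊆ Metric.closedBall (lf⁻¹ * (c x.letter - wordSum f x.before)) (r x.letter) := by
    intro x z hz
    have h := hcr _ (hstep x z hz)
    rw [Metric.mem_closedBall, dist_eq_norm] at h ⊢
    have e : lf * z + wordSum f x.before - c x.letter =
        lf * (z - lf⁻¹ * (c x.letter - wordSum f x.before)) := by
      field_simp
      ring
    rwa [e, norm_mul, hlf, one_mul] at h
  have hr := hθ.eq_of_forall_le (r := r) fun x => hmin _ _ _ (hpull x)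
  refine ⟨c, fun x => ?_⟩
  have h := minimal_closedBall_center_unique (hne x.1) (hcr x.1)
    (by simpa only [hr x.letter x.1] using hpull x) (hmin x.1)
  rw [h]
  field_simp
  ring

end Bounded

/-! ### The Perron–Frobenius weights and the mean. -/

section Integral

variable {𝒜 : Type*} [Fintype 𝒜] [DecidableEq 𝒜] [Nonempty 𝒜]

/-- The left eigenvector equation says that σ(θ(a)_j) sums over j to λσ(a). -/
theorem sum_weight_mul_source {θ : 𝒜 → List 𝒜} (hθ : IsPrimitive θ) (c : 𝒜 → ℂ) :
    ∑ x : State θ, ((sigmaHat hθ x * rhoHat hθ x : ℝ) : ℂ) * c x.1 =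
      ∑ a, (((perronFrobenius hθ).left a * (perronFrobenius hθ).right a : ℝ) : ℂ) * c a := by
  rw [Fintype.sum_sigma]
  refine Finset.sum_congr rfl fun a _ => ?_
  change ∑ j, ((sigmaHat hθ ⟨a, j⟩ * rhoHat hθ ⟨a, j⟩ : ℝ) : ℂ) * c a = _
  rw [← Finset.sum_mul, ← Complex.ofReal_sum]
  congr 2
  have h1 : ∑ j : Fin (θ a).length, (perronFrobenius hθ).left (θ a)[j.1] =
      (perronFrobenius hθ).val * (perronFrobenius hθ).left a := by
    have h := congrFun (perronFrobenius hθ).vecMul_left a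
    rw [Fin.sum_univ_fun_getElem, Finset.sum_list_map_count]
    rw [Pi.smul_apply, smul_eq_mul] at h
    rw [← h]
    simp only [Matrix.vecMul, dotProduct, substMatrixReal, substMatrix, Matrix.map_apply]
    rw [Finset.sum_subset (Finset.subset_univ _)]
    · exact Finset.sum_congr rfl fun b _ => by simp [mul_comm]
    · intro b _ hb
      rw [List.count_eq_zero_of_not_mem (by simpa using hb), zero_smul]
  have hv := (perronFrobenius hθ).val_pos.ne'
  simp only [sigmaHat, rhoHat, State.letter, List.get_eq_getElem]
  rw [← Finset.sum_mul, ← Finset.mul_sum, h1, inv_mul_cancel_left₀ hv]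

/-- Grouping positions by letter turns the sum over a into the right eigenvector equation. Source
and letter thus have the same distribution σρ under the weights. -/
theorem sum_weight_mul_letter {θ : 𝒜 → List 𝒜} (hθ : IsPrimitive θ) (c : 𝒜 → ℂ) :
    ∑ x : State θ, ((sigmaHat hθ x * rhoHat hθ x : ℝ) : ℂ) * c x.letter =
      ∑ a, (((perronFrobenius hθ).left a * (perronFrobenius hθ).right a : ℝ) : ℂ) * c a := by
  have hv : ((perronFrobenius hθ).val : ℂ) ≠ 0 :=
    Complex.ofReal_ne_zero.mpr (perronFrobenius hθ).val_pos.ne'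
  set P := perronFrobenius hθ with hP
  have h1 : ∀ a, ∑ j : Fin (θ a).length,
      (((sigmaHat hθ ⟨a, j⟩ * rhoHat hθ ⟨a, j⟩ : ℝ) : ℂ) * c (State.letter ⟨a, j⟩)) =
      ∑ b, (P.val : ℂ)⁻¹ * (P.left b * c b) * ((substMatrixReal θ b a * P.right a : ℝ) : ℂ) := by
    intro a
    have h2 := wordSum_eq_sum_count
      (fun b => (P.val : ℂ)⁻¹ * (P.left b * c b) * (P.right a : ℂ)) (θ a)
    rw [wordSum, ← Fin.sum_univ_fun_getElem] at h2
    refine Eq.trans (Finset.sum_congr rfl fun j _ => ?_) (h2.trans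
      (Finset.sum_congr rfl fun b _ => ?_))
    · simp only [sigmaHat, rhoHat, State.letter, List.get_eq_getElem, ← hP]
      push_cast
      ring
    · simp only [substMatrixReal, substMatrix, Matrix.map_apply]
      push_cast
      ring
  rw [Fintype.sum_sigma, Finset.sum_congr rfl fun a _ => h1 a, Finset.sum_comm]
  refine Finset.sum_congr rfl fun b _ => ?_
  rw [← Finset.mul_sum, ← Complex.ofReal_sum]
  have h3 : ∑ a, substMatrixReal θ b a * P.right a = P.val * P.right b :=
    congrFun P.mulVec_right b
  rw [h3]
  push_cast
  field_simp

/-- The integral of a (non-twisted) coboundary vanishes. -/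
theorem integralN_eq_zero {θ : 𝒜 → List 𝒜} (hθ : IsPrimitive θ) {f c : 𝒜 → ℂ}
    (hc : ∀ x : State θ, c x.letter = c x.1 + wordSum f x.before) : integralN hθ f = 0 := by
  have h : ∀ x : State θ, wordSum f x.before = c x.letter - c x.1 := fun x => by
    rw [hc x]; ring
  simp only [integralN, h, mul_sub, Finset.sum_sub_distrib]
  rw [sum_weight_mul_source, sum_weight_mul_letter, sub_self]

/-- If the sums of `f` over the language are bounded, then `S_f(θ(a)_{<j})` is its mean plus a
twisted coboundary. -/
theorem exists_wordSum_before_eq {θ : 𝒜 → List 𝒜} (hθ : IsPrimitive θ) {f : 𝒜 → ℂ} {lf : ℂ}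
    (hf : IsLeftEigenfunction θ f lf) (hlf : ‖lf‖ = 1) {C : ℝ}
    (hC : ∀ u ∈ language θ, ‖wordSum f u‖ ≤ C) :
    ∃ h : 𝒜 → ℂ, ∀ x : State θ,
      wordSum f x.before = integralN hθ f + h x.1 - lf⁻¹ * h x.letter := by
  have hlf0 : lf ≠ 0 := by rintro rfl; simp at hlf
  obtain ⟨c, hc⟩ := hθ.exists_transfer hf hlf hC
  have hS : ∀ x : State θ, wordSum f x.before = c x.letter - lf * c x.1 := fun x => by
    rw [hc x]; ring
  by_cases h1 : lf = 1
  -- Constants added to h cancel here, so the mean has to vanish.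
  · subst h1
    have h0 := integralN_eq_zero hθ (f := f) (c := c) fun x => by simpa using hc x
    refine ⟨fun a => -c a, fun x => ?_⟩
    rw [h0, hS x]
    ring
  -- A constant t in h contributes t(1 - λ_f⁻¹). The choice below makes this the negative of the
  -- mean.
  · have h2 : 1 - lf ≠ 0 := sub_ne_zero.mpr (Ne.symm h1)
    refine ⟨fun a => -lf * c a + integralN hθ f * lf / (1 - lf), fun x => ?_⟩
    rw [hS x]
    field_simp
    ring

end Integral

/-! ### From neighbour relations to a coboundary. -/

section Coboundary

variable {𝒜 : Type*}

/-- Telescoping; the last letter has no successor in the word, so its value of f remains. -/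
theorem wordSum_add_of_isChain {f h : 𝒜 → ℂ} {μ : ℂ} :
    ∀ {l : List 𝒜} (hl : l ≠ []), l.IsChain (fun a b => f a = μ * (h a - h b)) →
      wordSum f l = μ * (h (l.head hl) - h (l.getLast hl)) + f (l.getLast hl)
  | [a], _, _ => by simp [wordSum]
  | a :: b :: l, _, hc => by
    rw [List.isChain_cons_cons] at hc
    have ih := wordSum_add_of_isChain (l := b :: l) (by simp) hc.2
    have e : wordSum f (a :: b :: l) = f a + wordSum f (b :: l) := by simp [wordSum]
    rw [e, ih, hc.1]
    simp only [List.head_cons, List.getLast_cons_cons]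
    ring

/-- Only junctions between θ(c) and θ(d), for neighbours c, d, need an argument. The sum over θ(c)
is λ_f f(c) = h(c) - h(d); telescoping it isolates f at the last letter of θ(c), and the head
conditions for c and d turn the rest into h at the first letter of θ(d), with κ cancelling. -/
theorem isChain_iterate_extend {θ : 𝒜 → List 𝒜} (hne : ∀ a, θ a ≠ []) {f h : 𝒜 → ℂ} {lf κ : ℂ}
    (hlf : lf ≠ 0) (hf : ∀ a, wordSum f (θ a) = lf * f a)
    (hin : ∀ a, (θ a).IsChain fun b c => f b = lf⁻¹ * (h b - h c))
    (hhead : ∀ a, κ + h a - lf⁻¹ * h ((θ a).head (hne a)) = 0) (n : ℕ) (a : 𝒜) :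
    ((extend θ)^[n] [a]).IsChain fun b c => f b = lf⁻¹ * (h b - h c) := by
  induction n with
  | zero => simp
  | succ n ih =>
    rw [Function.iterate_succ_apply', extend, List.flatMap, List.isChain_flatten (by
      simpa using fun b _ => hne b)]
    refine ⟨by simpa using fun b _ => hin b, ?_⟩
    rw [List.isChain_map]
    refine ih.imp fun c d hcd => ?_
    intro x hx y hy
    rw [List.getLast?_eq_some_getLast (hne c), Option.mem_def, Option.some_inj] at hx
    rw [List.head?_eq_some_head (hne d), Option.mem_def, Option.some_inj] at hy
    subst hx hy
    have h1 := wordSum_add_of_isChain (hne c) (hin c)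
    rw [hf] at h1
    have h2 := hhead c
    have h3 := hhead d
    have h4 : lf * f c = h c - h d := by
      rw [hcd]; field_simp
    linear_combination h4 - h1 + h2 - h3

/-- The pair w₁w₂ lies in some θ^n(a), so the neighbour relation applies to it and the transfer
function depends on w₁ alone. -/
theorem isCoboundary_of_isChain {θ : 𝒜 → List 𝒜} [TopologicalSpace 𝒜] [DiscreteTopology 𝒜]
    {f h : 𝒜 → ℂ} {μ : ℂ}
    (hc : ∀ n a, ((extend θ)^[n] [a]).IsChain fun b c => f b = μ * (h b - h c)) :
    IsCoboundary (shift θ) (fun w : subshift θ => f (w.1 1)) := by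
  refine ⟨fun w => μ * h (w.1 1), ?_, fun w => ?_⟩
  · exact continuous_const.mul (continuous_of_discreteTopology.comp
      ((continuous_apply (1 : ℤ)).comp continuous_subtype_val))
  · obtain ⟨n, a, hna⟩ := w.2 1 2
    have h1 := (hc n a).infix hna
    simp [List.ofFn_succ] at h1
    simpa [shift, mul_sub] using h1

end Coboundary

/-! ### Compactness and nonemptiness of the subshift. -/

section Subshift

variable {𝒜 : Type*} [TopologicalSpace 𝒜] [DiscreteTopology 𝒜]

theorem isClosed_setOf_ofFn_mem (θ : 𝒜 → List 𝒜) (i : ℤ) (n : ℕ) :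
    IsClosed {x : ℤ → 𝒜 | List.ofFn (fun k : Fin n => x (i + (k : ℕ))) ∈ language θ} := by
  have h : Continuous fun (x : ℤ → 𝒜) (k : Fin n) => x (i + (k : ℕ)) := by fun_prop
  exact (isClosed_discrete {y : Fin n → 𝒜 | List.ofFn y ∈ language θ}).preimage h

theorem isCompact_subshift [Finite 𝒜] (θ : 𝒜 → List 𝒜) : IsCompact (subshift θ) := by
  refine IsClosed.isCompact ?_
  simp only [subshift, Set.ofPred_forall]
  exact isClosed_iInter fun i => isClosed_iInter fun n => isClosed_setOf_ofFn_mem θ i n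

theorem IsPrimitive.subshift_nonempty [Fintype 𝒜] [DecidableEq 𝒜] [Nontrivial 𝒜]
    {θ : 𝒜 → List 𝒜} (hθ : IsPrimitive θ) : (subshift θ).Nonempty := by
  -- Sequences whose window [-n, n) reads a word of the language: nested nonempty compact sets,
  -- whose common points lie in the subshift.
  let K : ℕ → Set (ℤ → 𝒜) := fun n =>
    {x | List.ofFn (fun k : Fin (2 * n) => x (-n + (k : ℕ))) ∈ language θ}
  have hcl : ∀ n, IsClosed (K n) := fun n => isClosed_setOf_ofFn_mem θ _ _
  have hne : ∀ n, (K n).Nonempty := by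
    intro n
    obtain ⟨v, hv, hvn⟩ := hθ.exists_length_eq (2 * n)
    obtain ⟨a, -⟩ := exists_pair_ne 𝒜
    -- A word v of length 2n is placed on [-n, n); values outside the window are irrelevant.
    refine ⟨fun i => v.getD (i + n).toNat a, ?_⟩
    have e : List.ofFn (fun k : Fin (2 * n) => v.getD (-(n : ℤ) + (k : ℕ) + n).toNat a) = v := by
      refine List.ext_getElem (by simp [hvn]) fun k hk1 hk2 => ?_
      simp [hk2]
    change List.ofFn (fun k : Fin (2 * n) => v.getD (-(n : ℤ) + (k : ℕ) + n).toNat a) ∈ language θ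
    rwa [e]
  have hanti : ∀ n, K (n + 1) ⊆ K n := fun n x hx =>
    mem_language_of_isInfix (ofFn_isInfix_ofFn x (by push_cast; omega) (by push_cast; omega)) hx
  obtain ⟨x, hx⟩ := IsCompact.nonempty_iInter_of_sequence_nonempty_isCompact_isClosed K hanti hne
    (hcl 0).isCompact hcl
  refine ⟨x, fun i n => ?_⟩
  have h1 := le_abs_self i
  have h2 := neg_abs_le i
  -- The window of length n at i fits inside [-(|i| + n), |i| + n).
  exact mem_language_of_isInfix (ofFn_isInfix_ofFn x (by push_cast; omega) (by push_cast; omega))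
    (Set.mem_iInter.mp hx (i.natAbs + n))

/-- The sums telescope to g(w) - g(T^N w), and g is bounded on the compact subshift; any point
serves as w. -/
theorem exists_bddAbove_of_isCoboundary [Fintype 𝒜] [DecidableEq 𝒜] [Nontrivial 𝒜]
    {θ : 𝒜 → List 𝒜} (hθ : IsPrimitive θ) {f : 𝒜 → ℂ}
    (h : IsCoboundary (shift θ) (fun w : subshift θ => f (w.1 1))) :
    ∃ w ∈ subshift θ, BddAbove (Set.range fun N : ℕ => ‖wordSum f (initialWord w N)‖) := by
  obtain ⟨g, hg, hfg⟩ := h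
  obtain ⟨w, hw⟩ := hθ.subshift_nonempty
  have : CompactSpace (subshift θ) := isCompact_iff_compactSpace.mp (isCompact_subshift θ)
  obtain ⟨C, hC⟩ := (isCompact_range hg).isBounded.exists_norm_le
  have hC' : ∀ x, ‖g x‖ ≤ C := fun x => hC _ ⟨x, rfl⟩
  have hshift : ∀ (N : ℕ) (i : ℤ), ((shift θ)^[N] ⟨w, hw⟩).1 i = w (i + N) := by
    intro N
    induction N with
    | zero => simp
    | succ N ih =>
      intro i
      rw [Function.iterate_succ_apply']
      change ((shift θ)^[N] ⟨w, hw⟩).1 (i + 1) = _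
      rw [ih]
      push_cast
      congr 1
      ring
  have hsum : ∀ N : ℕ, wordSum f (initialWord w N) = g ⟨w, hw⟩ - g ((shift θ)^[N] ⟨w, hw⟩) := by
    intro N
    induction N with
    | zero => simp [initialWord, wordSum]
    | succ N ih =>
      have e : initialWord w (N + 1) = initialWord w N ++ [w (N + 1)] := by
        rw [initialWord, List.ofFn_succ_last]
        simp [initialWord]
      have h1 := hfg ((shift θ)^[N] ⟨w, hw⟩)
      simp only [hshift] at h1
      rw [e, wordSum_append, ih, Function.iterate_succ_apply', add_comm (N : ℤ) 1]
      simp only [wordSum, List.map_cons, List.map_nil, List.sum_singleton, h1]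
      ring
  refine ⟨w, hw, C + C, ?_⟩
  rintro _ ⟨N, rfl⟩
  simp only [hsum]
  exact (norm_sub_le _ _).trans (add_le_add (hC' _) (hC' _))

end Subshift

/-! ### Prefix sums, their increments, and the equivalence. -/

theorem wordSum_take_succ {𝒜 : Type*} (f : 𝒜 → ℂ) (l : List 𝒜) (j : ℕ) (hj : j < l.length) :
    wordSum f (l.take (j + 1)) = wordSum f (l.take j) + f l[j] := by
  rw [← List.take_append_getElem hj, wordSum_append]
  simp [wordSum]

/-- The equivalence between the formula for the prefix sums and the formulas for its increments
and initial values. -/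
theorem wordSum_before_eq_iff {𝒜 : Type*} {θ : 𝒜 → List 𝒜} (hne : ∀ a, θ a ≠ []) (f h : 𝒜 → ℂ)
    (κ μ : ℂ) :
    (∀ x : State θ, wordSum f x.before = κ + h x.1 - μ * h x.letter) ↔
      (∀ (a : 𝒜) (j : ℕ) (hj : j + 1 < (θ a).length),
          f ((θ a)[j]'(Nat.lt_of_succ_lt hj)) =
            μ * (h ((θ a)[j]'(Nat.lt_of_succ_lt hj)) - h (θ a)[j + 1])) ∧
        (∀ a : 𝒜, κ + h a - μ * h ((θ a).head (hne a)) = 0) := by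
  constructor
  · intro H
    refine ⟨fun a j hj => ?_, fun a => ?_⟩
    · have h1 : wordSum f ((θ a).take j) = κ + h a - μ * h (θ a)[j] := H ⟨a, j, by omega⟩
      have h2 : wordSum f ((θ a).take (j + 1)) = κ + h a - μ * h (θ a)[j + 1] := H ⟨a, j + 1, hj⟩
      rw [wordSum_take_succ f _ j (by omega)] at h2
      linear_combination h2 - h1
    · have h0 := List.length_pos_of_ne_nil (hne a)
      have h1 : wordSum f ((θ a).take 0) = κ + h a - μ * h (θ a)[0] := H ⟨a, 0, h0⟩
      rw [List.head_eq_getElem, ← h1]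
      simp [wordSum]
  · rintro ⟨H1, H2⟩ ⟨a, j, hj⟩
    change wordSum f ((θ a).take j) = κ + h a - μ * h (θ a)[j]
    induction j with
    | zero =>
      rw [← List.head_eq_getElem (hne a), H2]
      simp [wordSum]
    | succ j ih =>
      rw [wordSum_take_succ f _ j (by omega), ih (by omega), H1 a j hj]
      ring

end SubstitutionSystem

theorem proposition3p3 {𝒜 : Type*} [Fintype 𝒜] [DecidableEq 𝒜] [Nontrivial 𝒜]
    [TopologicalSpace 𝒜] [DiscreteTopology 𝒜]
    (θ : 𝒜 → List 𝒜) (hθ : SubstitutionSystem.IsPrimitive θ)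
    (f : 𝒜 → ℂ) (lf : ℂ) (hf : SubstitutionSystem.IsLeftEigenfunction θ f lf)
    (hlf : ‖lf‖ = 1) :
    List.TFAE [
      SubstitutionSystem.IsCoboundary (SubstitutionSystem.shift θ)
        (fun w : SubstitutionSystem.subshift θ => f (w.1 1)),
      ∃ w ∈ SubstitutionSystem.subshift θ,
        BddAbove (Set.range fun N : ℕ =>
          ‖SubstitutionSystem.wordSum f (SubstitutionSystem.initialWord w N)‖),
      ∃ h : 𝒜 → ℂ, ∀ x : SubstitutionSystem.State θ,
        SubstitutionSystem.wordSum f x.before =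
          SubstitutionSystem.integralN hθ f + h x.1 - lf⁻¹ * h x.letter,
      ∃ h : 𝒜 → ℂ,
        (∀ (a : 𝒜) (j : ℕ) (hj : j + 1 < (θ a).length),
          f (θ a)[j] = lf⁻¹ * (h (θ a)[j] - h (θ a)[j + 1])) ∧
        (∀ a : 𝒜, SubstitutionSystem.integralN hθ f + h a -
          lf⁻¹ * h ((θ a).head (hθ.ne_nil a)) = 0)] := by
  have hlf0 : lf ≠ 0 := by rintro rfl; simp at hlf
  tfae_have 1 → 2 := SubstitutionSystem.exists_bddAbove_of_isCoboundary hθ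
  tfae_have 2 → 3 := by
    rintro ⟨w, hw, hb⟩
    obtain ⟨C, hC⟩ := hθ.exists_norm_wordSum_le hw hb
    exact SubstitutionSystem.exists_wordSum_before_eq hθ hf hlf hC
  tfae_have 3 ↔ 4 := exists_congr fun h =>
    SubstitutionSystem.wordSum_before_eq_iff hθ.ne_nil f h _ _
  tfae_have 4 → 1 := by
    rintro ⟨h, h1, h2⟩
    exact SubstitutionSystem.isCoboundary_of_isChain
      (SubstitutionSystem.isChain_iterate_extend hθ.ne_nil hlf0 hf.wordSum_apply
        (fun a => List.isChain_iff_getElem.mpr (h1 a)) h2)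
  tfae_finish
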